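/- **Theorem (Uniform lower bound).** *Setting.* Let $K\ge 2$ and let $\sigma^1,\dots,\sigma^K>0$ be fixed standard deviations. An instance is a joint law $P$ of outcomes $(Y^1,\dots,Y^K)$ with finite means $\mu^a(P)=\mathbb E_P[Y^a]$ and a unique best arm $a^*(P)=\arg\max_a\mu^a(P)$. Under $P$, vectors $(Y^1_t,\dots,Y^K_t)_{t\ge1}$ are i.i.d. with law $P$. A strategy $\pi$ specifies, for every budget $T$, arms $A_t\in[K]$ ($1\le t\le T$) that are measurable functions of $(A_s,Y_s)_{s<t}$, where $Y_s=Y_s^{A_s}$, and a recommendation $\widehat a^\pi_T\in[K]$ that is a measurable function of $(A_s,Y_s)_{s\le T}$. Let $\mathcal P$ be any class of instances that contains every law of independent Gaussian outcomes $Y^a\sim\mathcal N(\mu^a,(\sigma^a)^2)$, $\mu\in\mathbb R^K$, with a unique best arm (for example the class of all instances, or that of all Gaussian instances with variances $(\sigma^a)^2$). Put $\mathcal W=\{w:[K]\to(0,1):\sum_a w(a)=1\}$. The strategy $\pi$ is *consistent* if $\mathbb P_P(\widehat a^\pi_T=a^*(P))\to1$ as $T\to\infty$ for every $P\in\mathcal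 P$. It is *asymptotically invariant* if there is $w^\pi\in\mathcal W$ with $\mathbb E_P\big[\frac1T\sum_{t=1}^T\mathbf 1[A_t=a]\big]\to w^\pi(a)$ as $T\to\infty$ for every $P\in\mathcal P$ and $a\in[K]$. For $0<\underline\Delta\le\overline\Delta<\infty$ and $a^*\in[K]$ let $\mathcal P^{\mathrm G}(a^*,\underline\Delta,\overline\Delta)$ be the set of instances with $Y^a\sim\mathcal N(\mu^a,(\sigma^a)^2)$ for all $a$ (no restriction on the dependence between outcomes) and $\underline\Delta\le\mu^{a^*}-\mu^a\le\overline\Delta$ for all $a\ne a^*$. *Claim.* For any $0<\underline\Delta\le\overline\Delta<\infty$, any $a^*\in[K]$ and any $P_0\in\mathcal P^{\mathrm G}(a^*,\underline\Delta,\overline\Delta)$, every consistent and asymptotically invariant strategy $\pi$ satisfies $$\limsup_{T\to\infty}-\frac1T\log\mathbb P_{P_0}(\widehat a^\pi_T\ne a^*)\le\frac{\overline\Delta^2}{2\Big(\sigma^{a^*}+\sqrt{\sum_{a\ne a^*}(\sigma^a)^2}\Big)^2}$$ (with $-\log 0=+\infty$). Moreover the right-hand side equals $$\max_{w\in\mathcal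 W}\min_{a\ne a^*}\frac{\overline\Delta^2}{2\left(\frac{(\sigma^{a^*})^2}{w(a^*)}+\frac{(\sigma^a)^2}{w(a)}\right)},$$ and the unique maximizer is $$w^*(a^*)=\frac{\sigma^{a^*}}{\sigma^{a^*}+\sqrt{\sum_{b\ne a^*}(\sigma^b)^2}},\qquad w^*(a)=\frac{(\sigma^a)^2\big/\sqrt{\sum_{b\ne a^*}(\sigma^b)^2}}{\sigma^{a^*}+\sqrt{\sum_{b\ne a^*}(\sigma^b)^2}}\quad(a\ne a^*).$$ -/

import Mathlib

open MeasureTheory ProbabilityTheory Filter Topology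

noncomputable section

namespace FixedBudgetBAI

/-- A data-generating process: a joint law of the `K` potential outcomes `(Y^1, …, Y^K)`. -/
abbrev Instance (K : ℕ) := ProbabilityMeasure (Fin K → ℝ)

/-- The expected outcome of arm `a` under `P`. -/
def mean {K : ℕ} (P : Instance K) (a : Fin K) : ℝ :=
  ∫ y, y a ∂(P : Measure (Fin K → ℝ))

/-- `a` is the unique best arm under `P`. -/
def IsBestArm {K : ℕ} (P : Instance K) (a : Fin K) : Prop :=
  ∀ b, b ≠ a → mean P b < mean P a

/-- All joint laws with finite expected outcomes and a unique best arm. -/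
def allInstances (K : ℕ) : Set (Instance K) :=
  {P | (∀ a, Integrable (fun y : Fin K → ℝ => y a) (P : Measure (Fin K → ℝ))) ∧
    ∃ a, IsBestArm P a}

/-- The law of `K` independent Gaussian outcomes with means `μ a` and standard deviations `σ a`. -/
def gaussianInstance {K : ℕ} (σ μ : Fin K → ℝ) : Instance K :=
  ⟨Measure.pi fun a => gaussianReal (μ a) (σ a ^ 2).toNNReal, inferInstance⟩

/-- The Gaussian bandit model: outcome `a` has law `N(μ a, (σ a)²)`, with no restriction on the
dependence between the outcomes, and all gaps to the best arm `astar` lie in `[Δlo, Δhi]`. -/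
def gaussianModel {K : ℕ} (σ : Fin K → ℝ) (astar : Fin K) (Δlo Δhi : ℝ) : Set (Instance K) :=
  {P | P ∈ allInstances K ∧ ∃ μ : Fin K → ℝ,
    (∀ a, (P : Measure (Fin K → ℝ)).map (fun y => y a) =
      gaussianReal (μ a) (σ a ^ 2).toNNReal) ∧
    ∀ a, a ≠ astar → Δlo ≤ μ astar - μ a ∧ μ astar - μ a ≤ Δhi}

/-- A strategy. For each budget `T`, `alloc T t` chooses the arm of round `t + 1` from the
observations `(A_1, Y_1), …, (A_t, Y_t)`, and `recommend T` estimates the best arm from all `T`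
observations. Both are measurable functions of the observations. Only the values `alloc T t` with
`t < T` are ever used. -/
structure Strategy (K : ℕ) where
  alloc : (T t : ℕ) → (Fin t → Fin K × ℝ) → Fin K
  measurable_alloc : ∀ T t, Measurable (alloc T t)
  recommend : (T : ℕ) → (Fin T → Fin K × ℝ) → Fin K
  measurable_recommend : ∀ T, Measurable (recommend T)

namespace Strategy

variable {K : ℕ}

/-- The first `t` observations of the experiment with budget `T`, when the potential outcomes of
round `s + 1` are `y s`. -/
def history (π : Strategy K) (T : ℕ) (y : ℕ → Fin K → ℝ) : (t : ℕ) → Fin t → Fin K × ℝ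
  | 0 => Fin.elim0
  | t + 1 =>
    Fin.snoc (α := fun _ => Fin K × ℝ) (history π T y t)
      (π.alloc T t (history π T y t), y t (π.alloc T t (history π T y t)))

/-- The arm allocated in round `t + 1`. -/
def arm (π : Strategy K) (T t : ℕ) (y : ℕ → Fin K → ℝ) : Fin K :=
  π.alloc T t (π.history T y t)

/-- The arm recommended at the end of the experiment. -/
def recommended (π : Strategy K) (T : ℕ) (y : ℕ → Fin K → ℝ) : Fin K :=
  π.recommend T (π.history T y T)

end Strategy

/-- The law of the i.i.d. sequence of potential outcome vectors under `P`. -/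
def outcomeLaw {K : ℕ} (P : Instance K) : Measure (ℕ → Fin K → ℝ) :=
  Measure.infinitePi fun _ : ℕ => (P : Measure (Fin K → ℝ))

/-- The average sample allocation ratio `κ_{T,P}(a)`. -/
def allocationRatio {K : ℕ} (π : Strategy K) (T : ℕ) (P : Instance K) (a : Fin K) : ℝ :=
  ∫ y, (1 / (T : ℝ)) * ∑ t ∈ Finset.range T, (if π.arm T t y = a then (1 : ℝ) else 0)
    ∂(outcomeLaw P)

/-- The simplex of allocations `w : [K] → (0, 1)` with total mass one. -/
def allocations (K : ℕ) : Set (Fin K → ℝ) :=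
  {w | (∀ a, w a ∈ Set.Ioo (0 : ℝ) 1) ∧ ∑ a, w a = 1}

/-- Consistency on a class `ℳ` of instances: the best arm is recommended with probability tending
to one. -/
def IsConsistent {K : ℕ} (ℳ : Set (Instance K)) (π : Strategy K) : Prop :=
  ∀ P ∈ ℳ, ∀ a, IsBestArm P a →
    Tendsto (fun T : ℕ => outcomeLaw P {y | π.recommended T y = a}) atTop (𝓝 1)

/-- Asymptotic invariance on a class `ℳ`: the average allocation ratios converge to a limit in the
simplex which is the same for all instances in `ℳ`. -/
def IsAsymptoticallyInvariant {K : ℕ} (ℳ : Set (Instance K)) (π : Strategy K) : Prop :=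
  ∃ w ∈ allocations K, ∀ P ∈ ℳ, ∀ a,
    Tendsto (fun T : ℕ => allocationRatio π T P a) atTop (𝓝 (w a))

/-- The complexity `-(1/T) log ℙ_P(â_T ≠ a)`, equal to `+∞` if the probability is zero. -/
def complexity {K : ℕ} (π : Strategy K) (P : Instance K) (a : Fin K) (T : ℕ) : EReal :=
  ((-(1 / (T : ℝ)) : ℝ) : EReal) * ENNReal.log (outcomeLaw P {y | π.recommended T y ≠ a})

/-- `Ω^{b,a}(w) = (σ^b)² / w(b) + (σ^a)² / w(a)`. -/
def Omega {K : ℕ} (σ w : Fin K → ℝ) (b a : Fin K) : ℝ :=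
  σ b ^ 2 / w b + σ a ^ 2 / w a

/-- `√(∑_{a ≠ astar} (σ^a)²)`. -/
def restDeviation {K : ℕ} (σ : Fin K → ℝ) (astar : Fin K) : ℝ :=
  Real.sqrt (∑ a ∈ Finset.univ.erase astar, σ a ^ 2)

/-- The target allocation ratio for the best arm `astar`. -/
def targetAllocation {K : ℕ} (σ : Fin K → ℝ) (astar a : Fin K) : ℝ :=
  if a = astar then σ astar / (σ astar + restDeviation σ astar)
  else (σ a ^ 2 / restDeviation σ astar) / (σ astar + restDeviation σ astar)

/-- The uniform bound `Δ² / (2 (σ^{astar} + √(∑_{a ≠ astar} (σ^a)²))²)`. -/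
def uniformBound {K : ℕ} (σ : Fin K → ℝ) (astar : Fin K) (Δ : ℝ) : ℝ :=
  Δ ^ 2 / (2 * (σ astar + restDeviation σ astar) ^ 2)

/-- The objective `min_{a ≠ astar} Δ² / (2 Ω^{astar,a}(w))`. -/
def allocationValue {K : ℕ} (σ : Fin K → ℝ) (astar : Fin K) (Δ : ℝ) (w : Fin K → ℝ) : ℝ :=
  ⨅ a : {a : Fin K // a ≠ astar}, Δ ^ 2 / (2 * Omega σ w astar a)

end FixedBudgetBAI

end

/-! The upper bound on the error exponent comes from a change of measure to instances in which
another arm is best. Let `Q` be an independent Gaussian instance with means `ν` whose best arm is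
not `astar`. Consistency makes the error event `A = {â ≠ astar}` have `Q`-probability tending to
one, and `mul_exp_neg_le_measureReal` then forces `-log P₀(A)` to be at most about the `Q`-mean of
the log-likelihood ratio of the history. Each round reveals only one outcome, so the likelihood
ratio involves only the marginals (`map_history_eq_withDensity`) and dependence between outcomes
under `P₀` is harmless.

By `integral_historyLLR` that mean is `T` times the sum of Gaussian divergences weighted by the
allocation ratios under `Q`. Asymptotic invariance replaces these ratios by a limit `w` that does
not depend on `Q`, so `ν` may be chosen after `w`. Bringing only `astar` and one rival `a` to a
common mean, at the cheapest point, gives the exponent `(μ astar - μ a)² / (2 Ω)`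
(`limsup_complexity_le_Omega`).

Gaps are at most `Δhi`, so minimizing over `a` bounds the exponent by `allocationValue` at `w`. What
remains is a finite-dimensional max-min problem: its unique solution equalizes all `Ω`
(`eq_targetAllocation_of_Omega_le`). -/

namespace FixedBudgetBAI

/-! ### The max-min allocation problem. -/

section Allocation
variable {K : ℕ} {σ : Fin K → ℝ} {astar : Fin K}

lemma restDeviation_sq (σ : Fin K → ℝ) (astar : Fin K) :
    restDeviation σ astar ^ 2 = ∑ a ∈ Finset.univ.erase astar, σ a ^ 2 :=
  Real.sq_sqrt (Finset.sum_nonneg fun _ _ => sq_nonneg _)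

lemma exists_ne_of_two_le (hK : 2 ≤ K) (astar : Fin K) : ∃ a : Fin K, a ≠ astar := by
  have : Nontrivial (Fin K) := Fin.nontrivial_iff_two_le.2 hK
  exact exists_ne astar

lemma restDeviation_pos (hK : 2 ≤ K) (hσ : ∀ a, 0 < σ a) (astar : Fin K) :
    0 < restDeviation σ astar := by
  obtain ⟨a, ha⟩ := exists_ne_of_two_le hK astar
  exact Real.sqrt_pos.2 (Finset.sum_pos (fun b _ => pow_pos (hσ b) 2) ⟨a, by simp [ha]⟩)

lemma sum_erase_targetAllocation (hK : 2 ≤ K) (hσ : ∀ a, 0 < σ a) (astar : Fin K) :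
    ∑ a ∈ Finset.univ.erase astar, targetAllocation σ astar a =
      restDeviation σ astar / (σ astar + restDeviation σ astar) := by
  have hR := restDeviation_pos hK hσ astar
  have : ∀ a ∈ Finset.univ.erase astar, targetAllocation σ astar a =
      σ a ^ 2 * (1 / (restDeviation σ astar * (σ astar + restDeviation σ astar))) := by
    intro a ha
    rw [targetAllocation, if_neg (Finset.ne_of_mem_erase ha)]
    have := hσ astar
    field_simp
  have hs := hσ astar
  rw [Finset.sum_congr rfl this, ← Finset.sum_mul, ← restDeviation_sq]
  field_simp

lemma sum_targetAllocation (hK : 2 ≤ K) (hσ : ∀ a, 0 < σ a) (astar : Fin K) :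
    ∑ a, targetAllocation σ astar a = 1 := by
  have hR := restDeviation_pos hK hσ astar
  have hs := hσ astar
  rw [← Finset.add_sum_erase _ _ (Finset.mem_univ astar), sum_erase_targetAllocation hK hσ,
    targetAllocation, if_pos rfl]
  field_simp

lemma targetAllocation_pos (hK : 2 ≤ K) (hσ : ∀ a, 0 < σ a) (astar a : Fin K) :
    0 < targetAllocation σ astar a := by
  have hR := restDeviation_pos hK hσ astar
  have hs := hσ astar
  have ha := hσ a
  unfold targetAllocation
  split_ifs <;> positivity

lemma targetAllocation_mem (hK : 2 ≤ K) (hσ : ∀ a, 0 < σ a) (astar : Fin K) :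
    targetAllocation σ astar ∈ allocations K := by
  refine ⟨fun a => ⟨targetAllocation_pos hK hσ astar a, ?_⟩, sum_targetAllocation hK hσ astar⟩
  obtain ⟨b, hb⟩ := exists_ne_of_two_le hK a
  rw [← sum_targetAllocation hK hσ astar]
  exact Finset.single_lt_sum hb (Finset.mem_univ _) (Finset.mem_univ _)
    (targetAllocation_pos hK hσ astar b) fun c _ _ => (targetAllocation_pos hK hσ astar c).le

/-- With `s = σ astar` and `R = restDeviation σ astar`, the two summands are `s (s + R)` and `R (s +
R)`: the target allocation makes all rivals equally hard to separate from `astar`. -/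
lemma Omega_targetAllocation (hK : 2 ≤ K) (hσ : ∀ a, 0 < σ a) {a : Fin K} (ha : a ≠ astar) :
    Omega σ (targetAllocation σ astar) astar a = (σ astar + restDeviation σ astar) ^ 2 := by
  have hR := restDeviation_pos hK hσ astar
  have hs := hσ astar
  have hsa := hσ a
  rw [Omega, targetAllocation, if_pos rfl, targetAllocation, if_neg ha]
  field_simp

lemma Omega_pos {w : Fin K → ℝ} (hσ : ∀ a, 0 < σ a) (hw : w ∈ allocations K) (b a : Fin K) :
    0 < Omega σ w b a :=
  add_pos (div_pos (pow_pos (hσ b) 2) (hw.1 b).1) (div_pos (pow_pos (hσ a) 2) (hw.1 a).1)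

/-- Only the target allocation keeps every `Ω^{astar,a}` below its optimal common value. -/
lemma eq_targetAllocation_of_Omega_le (hK : 2 ≤ K) (hσ : ∀ a, 0 < σ a) {w : Fin K → ℝ}
    (hw : w ∈ allocations K)
    (h : ∀ a, a ≠ astar → Omega σ w astar a ≤ (σ astar + restDeviation σ astar) ^ 2) :
    w = targetAllocation σ astar := by
  have hR := restDeviation_pos hK hσ astar
  have hRsq := restDeviation_sq σ astar
  have hs := hσ astar
  have hu := (hw.1 astar).1
  have hsum : w astar + ∑ a ∈ Finset.univ.erase astar, w a = 1 := by
    rw [Finset.add_sum_erase _ _ (Finset.mem_univ astar), hw.2]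
  set R := restDeviation σ astar
  set s := σ astar
  set u := w astar with hu_def
  have hle : ∀ a ∈ Finset.univ.erase astar, σ a ^ 2 ≤ w a * ((s + R) ^ 2 - s ^ 2 / u) := by
    intro a ha
    have h1 := h a (Finset.ne_of_mem_erase ha)
    have hwa := (hw.1 a).1
    have h2 : σ a ^ 2 / w a ≤ (s + R) ^ 2 - s ^ 2 / u := by
      rw [Omega] at h1; linarith
    rwa [div_le_iff₀ hwa, mul_comm] at h2
  -- Summing the constraints over the rivals leaves one inequality in `u` alone.
  have h3 : R ^ 2 ≤ (1 - u) * ((s + R) ^ 2 - s ^ 2 / u) := by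
    rw [hRsq, ← hsum, add_sub_cancel_left, Finset.sum_mul]
    exact Finset.sum_le_sum hle
  -- After multiplication by `u`, that inequality is a perfect square being nonpositive, which
  -- determines `u`.
  have h4 : ((s + R) * u - s) ^ 2 ≤ 0 := by
    have h5 := mul_le_mul_of_nonneg_left h3 hu.le
    have h6 : u * ((1 - u) * ((s + R) ^ 2 - s ^ 2 / u)) = (1 - u) * ((s + R) ^ 2 * u - s ^ 2) := by
      field_simp
    nlinarith
  have h7 : (s + R) * u = s := by
    have := pow_eq_zero_iff (two_ne_zero) |>.1 (le_antisymm h4 (sq_nonneg _))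
    linarith
  have hueq : u = s / (s + R) := by
    field_simp; linarith
  have hD : (s + R) ^ 2 - s ^ 2 / u = R * (s + R) := by
    rw [hueq]; field_simp; ring
  -- With `u` known, each constraint bounds `w a` below by its target; the totals agree, so no
  -- inequality can be strict.
  have hge : ∀ a ∈ Finset.univ.erase astar, targetAllocation σ astar a ≤ w a := by
    intro a ha
    have h8 := hle a ha
    rw [hD] at h8
    rw [targetAllocation, if_neg (Finset.ne_of_mem_erase ha)]
    change σ a ^ 2 / R / (s + R) ≤ w a
    rwa [div_div, div_le_iff₀ (by positivity)]
  have hsumeq : ∑ a ∈ Finset.univ.erase astar, targetAllocation σ astar a =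
      ∑ a ∈ Finset.univ.erase astar, w a := by
    rw [sum_erase_targetAllocation hK hσ]
    change R / (s + R) = _
    have : ∑ a ∈ Finset.univ.erase astar, w a = 1 - u := by linarith
    rw [this, hueq]; field_simp; ring
  funext a
  by_cases ha : a = astar
  · subst ha
    rw [targetAllocation, if_pos rfl]
    exact hueq
  · exact (((Finset.sum_eq_sum_iff_of_le hge).1 hsumeq) a (by simp [ha])).symm

lemma allocationValue_targetAllocation (hK : 2 ≤ K) (hσ : ∀ a, 0 < σ a) (astar : Fin K) (Δ : ℝ) :
    allocationValue σ astar Δ (targetAllocation σ astar) = uniformBound σ astar Δ := by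
  obtain ⟨a, ha⟩ := exists_ne_of_two_le hK astar
  have : Nonempty {a : Fin K // a ≠ astar} := ⟨⟨a, ha⟩⟩
  rw [allocationValue, uniformBound]
  simp_rw [fun b : {a : Fin K // a ≠ astar} => Omega_targetAllocation hK hσ b.2]
  exact ciInf_const

/-- Reaching the bound already identifies `w`, so this yields both optimality of the target and
uniqueness of the maximizer. -/
lemma eq_targetAllocation_of_uniformBound_le (hK : 2 ≤ K) (hσ : ∀ a, 0 < σ a) {Δ : ℝ} (hΔ : 0 < Δ)
    {w : Fin K → ℝ} (hw : w ∈ allocations K)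
    (h : uniformBound σ astar Δ ≤ allocationValue σ astar Δ w) : w = targetAllocation σ astar := by
  have hR := restDeviation_pos hK hσ astar
  have hs := hσ astar
  refine eq_targetAllocation_of_Omega_le hK hσ hw fun a ha => ?_
  have hO := Omega_pos hσ hw astar a
  have h1 : uniformBound σ astar Δ ≤ Δ ^ 2 / (2 * Omega σ w astar a) :=
    h.trans (ciInf_le (Set.finite_range _).bddBelow (⟨a, ha⟩ : {a : Fin K // a ≠ astar}))
  rw [uniformBound, div_le_div_iff_of_pos_left (by positivity) (by positivity) (by positivity)] at h1
  linarith

lemma allocationValue_le_uniformBound (hK : 2 ≤ K) (hσ : ∀ a, 0 < σ a) {Δ : ℝ} (hΔ : 0 < Δ)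
    {w : Fin K → ℝ} (hw : w ∈ allocations K) :
    allocationValue σ astar Δ w ≤ uniformBound σ astar Δ := by
  by_contra! h
  rw [eq_targetAllocation_of_uniformBound_le hK hσ hΔ hw h.le,
    allocationValue_targetAllocation hK hσ] at h
  exact lt_irrefl _ h

lemma setOf_isMaxOn_allocationValue (hK : 2 ≤ K) (hσ : ∀ a, 0 < σ a) (astar : Fin K) {Δ : ℝ}
    (hΔ : 0 < Δ) :
    {w | w ∈ allocations K ∧ IsMaxOn (allocationValue σ astar Δ) (allocations K) w} =
      {targetAllocation σ astar} := by
  ext w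
  constructor
  · rintro ⟨hw, hmax⟩
    refine eq_targetAllocation_of_uniformBound_le hK hσ hΔ hw ?_
    rw [← allocationValue_targetAllocation hK hσ]
    exact hmax (targetAllocation_mem hK hσ astar)
  · rintro rfl
    refine ⟨targetAllocation_mem hK hσ astar, fun v hv => ?_⟩
    change allocationValue σ astar Δ v ≤ _
    rw [allocationValue_targetAllocation hK hσ]
    exact allocationValue_le_uniformBound hK hσ hΔ hv

end Allocation

/-! ### The law of the observed history and its change of measure. -/

section History
variable {K : ℕ}

instance (P : Instance K) : IsProbabilityMeasure (outcomeLaw P) := by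
  unfold outcomeLaw; infer_instance

lemma measurable_apply_arm : Measurable fun p : (Fin K → ℝ) × Fin K => p.1 p.2 :=
  measurable_from_prod_countable_left fun a => measurable_pi_apply a

namespace Strategy

lemma measurable_history (π : Strategy K) (T t : ℕ) :
    Measurable fun y : ℕ → Fin K → ℝ => π.history T y t := by
  induction t with
  | zero => exact measurable_pi_iff.2 fun s => s.elim0
  | succ t ih =>
    have hA : Measurable fun y : ℕ → Fin K → ℝ => π.alloc T t (π.history T y t) :=
      (π.measurable_alloc T t).comp ih
    refine measurable_pi_iff.2 fun s => ?_
    refine Fin.lastCases ?_ (fun s => ?_) s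
    · simp only [history, Fin.snoc_last]
      exact hA.prodMk (measurable_apply_arm.comp ((measurable_pi_apply t).prodMk hA))
    · simp only [history, Fin.snoc_castSucc]
      exact (measurable_pi_apply s).comp ih

lemma measurable_arm (π : Strategy K) (T t : ℕ) : Measurable (π.arm T t) :=
  (π.measurable_alloc T t).comp (π.measurable_history T t)

lemma history_apply (π : Strategy K) (T t : ℕ) (y : ℕ → Fin K → ℝ) (s : Fin t) :
    π.history T y t s = (π.arm T s y, y s (π.arm T s y)) := by
  induction t with
  | zero => exact s.elim0
  | succ t ih =>
    refine Fin.lastCases ?_ (fun s => ?_) s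
    · simp [history, arm]
    · simpa [history] using ih s

lemma history_congr (π : Strategy K) (T t : ℕ) {y z : ℕ → Fin K → ℝ} (h : ∀ s < t, y s = z s) :
    π.history T y t = π.history T z t := by
  induction t with
  | zero => rfl
  | succ t ih =>
    simp only [history, ih fun s hs => h s (hs.trans t.lt_succ_self), h t t.lt_succ_self]

/-- The history after `t` rounds is a function of the outcome vectors with index below `t`, which
are independent of vector `t`. -/
lemma indepFun_history (π : Strategy K) (T t : ℕ) (P : Instance K) :
    IndepFun (fun y => π.history T y t) (fun y => y t) (outcomeLaw P) := by
  have hind : iIndepFun (fun (s : ℕ) (y : ℕ → Fin K → ℝ) => y s) (outcomeLaw P) :=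
    iIndepFun_infinitePi (P := fun _ : ℕ => (P : Measure (Fin K → ℝ))) (X := fun _ x => x)
      fun _ => measurable_id
  have h := hind.indepFun_finset (Finset.range t) {t} (by simp)
    fun s => measurable_pi_apply s
  -- Padding with zeros feeds the first `t` vectors to `history`, which never reads the padded
  -- entries.
  let ext : (Finset.range t → Fin K → ℝ) → ℕ → Fin K → ℝ :=
    fun x s => if hs : s ∈ Finset.range t then x ⟨s, hs⟩ else 0
  have hext : Measurable ext := by
    refine measurable_pi_iff.2 fun s => ?_
    by_cases hs : s ∈ Finset.range t
    · simp only [ext, hs, dite_true]; exact measurable_pi_apply _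
    · simp only [ext, hs, dite_false]; exact measurable_const
  have h2 := h.comp ((π.measurable_history T t).comp hext)
    (measurable_pi_apply (⟨t, Finset.mem_singleton_self t⟩ : ({t} : Finset ℕ)))
  convert h2 using 1
  · funext y
    refine π.history_congr T t fun s hs => ?_
    simp [ext, hs]
  · rfl

end Strategy

lemma outcomeLaw_map_eval (P : Instance K) (t : ℕ) :
    (outcomeLaw P).map (fun y => y t) = (P : Measure (Fin K → ℝ)) :=
  Measure.infinitePi_map_eval (fun _ : ℕ => (P : Measure (Fin K → ℝ))) t

lemma measurable_snoc {t : ℕ} :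
    Measurable fun p : (Fin t → Fin K × ℝ) × (Fin K × ℝ) =>
      Fin.snoc (α := fun _ => Fin K × ℝ) p.1 p.2 := by
  refine measurable_pi_iff.2 fun s => ?_
  refine Fin.lastCases ?_ (fun s => ?_) s
  · simp only [Fin.snoc_last]; exact measurable_snd
  · simp only [Fin.snoc_castSucc]; exact (measurable_pi_apply s).comp measurable_fst

lemma measurable_snoc_alloc (π : Strategy K) (T t : ℕ) :
    Measurable fun p : (Fin t → Fin K × ℝ) × (Fin K → ℝ) =>
      Fin.snoc (α := fun _ => Fin K × ℝ) p.1 (π.alloc T t p.1, p.2 (π.alloc T t p.1)) := by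
  have hA : Measurable fun p : (Fin t → Fin K × ℝ) × (Fin K → ℝ) => π.alloc T t p.1 :=
    (π.measurable_alloc T t).comp measurable_fst
  exact measurable_snoc.comp (measurable_fst.prodMk
    (hA.prodMk (measurable_apply_arm.comp (measurable_snd.prodMk hA))))

/-- Given the past, the next arm is fixed and the next vector is fresh, so only the marginal of that
arm enters. This is where the dependence between outcomes drops out. -/
lemma lintegral_history_succ (π : Strategy K) (T t : ℕ) (P : Instance K)
    {f : (Fin (t + 1) → Fin K × ℝ) → ENNReal} (hf : Measurable f) :
    ∫⁻ h, f h ∂((outcomeLaw P).map fun y => π.history T y (t + 1)) =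
      ∫⁻ h, ∫⁻ x, f (Fin.snoc (α := fun _ => Fin K × ℝ) h (π.alloc T t h, x))
        ∂((P : Measure (Fin K → ℝ)).map fun z => z (π.alloc T t h))
        ∂((outcomeLaw P).map fun y => π.history T y t) := by
  have hH := π.measurable_history T t
  have hprod := (indepFun_iff_map_prod_eq_prod_map_map hH.aemeasurable
    (measurable_pi_apply t).aemeasurable).1 (π.indepFun_history T t P)
  rw [outcomeLaw_map_eval] at hprod
  have hG := hf.comp (measurable_snoc_alloc π T t)
  rw [lintegral_map hf (π.measurable_history T (t + 1))]
  have h1 := lintegral_map (μ := outcomeLaw P) hG (hH.prodMk (measurable_pi_apply t))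
  rw [hprod, lintegral_prod _ hG.aemeasurable] at h1
  refine h1.symm.trans (lintegral_congr fun h => ?_)
  rw [lintegral_map _ (measurable_pi_apply _)]
  · rfl
  exact hf.comp (measurable_snoc.comp (measurable_const.prodMk
    (measurable_const.prodMk measurable_id)))

/-- Change of measure for the observed history: only the marginals of the outcomes matter. -/
lemma map_history_eq_withDensity (π : Strategy K) (T : ℕ) (P Q : Instance K)
    {g : Fin K → ℝ → ENNReal} (hg : ∀ a, Measurable (g a))
    (h : ∀ a, (P : Measure (Fin K → ℝ)).map (fun z => z a) =
      ((Q : Measure (Fin K → ℝ)).map fun z => z a).withDensity (g a)) (t : ℕ) :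
    (outcomeLaw P).map (fun y => π.history T y t) =
      ((outcomeLaw Q).map fun y => π.history T y t).withDensity
        fun x => ∏ s, g (x s).1 (x s).2 := by
  have hg' : Measurable fun p : Fin K × ℝ => g p.1 p.2 :=
    measurable_from_prod_countable_right hg
  have hden (n : ℕ) : Measurable fun x : Fin n → Fin K × ℝ => ∏ s, g (x s).1 (x s).2 :=
    Finset.measurable_prod _ fun s _ => hg'.comp (measurable_pi_apply s)
  induction t with
  | zero =>
    ext s hs
    have : (fun x : Fin 0 → Fin K × ℝ => ∏ s, g (x s).1 (x s).2) = 1 := by funext x; simp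
    rw [this, withDensity_one]
    congr 1
    have he : (fun y : ℕ → Fin K → ℝ => π.history T y 0) = fun _ => Fin.elim0 := rfl
    rw [he, Measure.map_const, Measure.map_const, measure_univ, measure_univ]
  | succ t ih =>
    refine Measure.ext_of_lintegral _ fun f hf => ?_
    rw [lintegral_withDensity_eq_lintegral_mul _ (hden _) hf,
      lintegral_history_succ π T t P hf, lintegral_history_succ π T t Q ((hden _).mul hf), ih]
    have hfx (k : Fin t → Fin K × ℝ) : Measurable fun x : ℝ =>
        f (Fin.snoc (α := fun _ => Fin K × ℝ) k (π.alloc T t k, x)) :=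
      hf.comp (measurable_snoc.comp (measurable_const.prodMk
        (measurable_const.prodMk measurable_id)))
    rw [lintegral_withDensity_eq_lintegral_mul _ (hden _)]
    · refine lintegral_congr fun k => ?_
      simp only [Pi.mul_apply]
      -- The marginal of `P` becomes that of `Q` weighted by `g`. The density of `k`, constant in
      -- `x`, moves under the integral and completes the product over `t + 1` observations.
      rw [h, lintegral_withDensity_eq_lintegral_mul _ (hg _) (hfx k),
        ← lintegral_const_mul _ ((hg _).mul (hfx k))]
      refine lintegral_congr fun x => ?_
      simp [Fin.prod_univ_castSucc, mul_assoc]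
    -- Measurability of the inner integral in `k`: its measure varies with the chosen arm, so it is
    -- rewritten as an integral over the whole outcome vector under the fixed law `P`.
    · have := (hf.comp (measurable_snoc_alloc π T t)).lintegral_prod_right' (ν := (P : Measure (Fin K → ℝ)))
      convert this using 2 with k
      rw [lintegral_map (hfx k) (measurable_pi_apply _)]
      rfl

end History

/-! ### Change of measure for events, and Gaussian likelihood ratios. -/

section ChangeOfMeasure

/-- Change-of-measure bound for the probability of an event, in terms of the mean of the
log-likelihood ratio. -/
lemma mul_exp_neg_le_measureReal {Ω : Type*} [MeasurableSpace Ω] {P Q : Measure Ω}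
    [IsProbabilityMeasure P] [IsProbabilityMeasure Q] {L : Ω → ℝ} (hL : Measurable L)
    (hLi : Integrable L Q) (hPQ : P = Q.withDensity fun x => ENNReal.ofReal (Real.exp (-L x)))
    {A : Set Ω} (hA : MeasurableSet A) (hq : 0 < Q.real A) :
    Q.real A * Real.exp (-((∫ x, L x ∂Q + 1) / Q.real A)) ≤ P.real A := by
  have hmeas : Measurable fun x => Real.exp (-L x) := Real.measurable_exp.comp hL.neg
  have hlint : ∫⁻ x, ENNReal.ofReal (Real.exp (-L x)) ∂Q = 1 := by
    rw [← setLIntegral_univ, ← withDensity_apply _ MeasurableSet.univ, ← hPQ, measure_univ]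
  have hexp : Integrable (fun x => Real.exp (-L x)) Q := by
    refine ⟨hmeas.aestronglyMeasurable, ?_⟩
    rw [hasFiniteIntegral_iff_ofReal (ae_of_all _ fun x => (Real.exp_pos _).le), hlint]
    exact ENNReal.one_lt_top
  have hint : ∫ x, Real.exp (-L x) ∂Q = 1 := by
    rw [integral_eq_lintegral_of_nonneg_ae (ae_of_all _ fun x => (Real.exp_pos _).le)
      hmeas.aestronglyMeasurable, hlint, ENNReal.toReal_one]
  have hPA : P.real A = ∫ x in A, Real.exp (-L x) ∂Q := by
    rw [integral_eq_lintegral_of_nonneg_ae (ae_of_all _ fun x => (Real.exp_pos _).le)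
      hmeas.aestronglyMeasurable, measureReal_def, hPQ, withDensity_apply _ hA]
  -- Off `A`, `-L ≤ exp (-L)`, whose integral is at most one. This is the source of the `+ 1`, which
  -- becomes negligible after division by `T`.
  have hLA : ∫ x in A, L x ∂Q ≤ ∫ x, L x ∂Q + 1 := by
    have h1 : ∫ x in Aᶜ, -L x ∂Q ≤ ∫ x in Aᶜ, Real.exp (-L x) ∂Q :=
      integral_mono hLi.neg.integrableOn hexp.integrableOn fun x => by
        have := Real.add_one_le_exp (-L x)
        simp only
        linarith
    have h2 : ∫ x in Aᶜ, Real.exp (-L x) ∂Q ≤ 1 :=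
      hint ▸ setIntegral_le_integral hexp (ae_of_all _ fun x => (Real.exp_pos _).le)
    rw [integral_neg] at h1
    have h3 := integral_add_compl hA hLi
    linarith
  set q := Q.real A
  set c := (∫ x, L x ∂Q + 1) / q with hc
  have hcq : c * q = ∫ x, L x ∂Q + 1 := div_mul_cancel₀ _ hq.ne'
  -- Tangent line of `exp` at `-c`. The choice of `c` makes `c * q` dominate the integral of `L`
  -- over `A`, so a factor `q * exp (-c)` survives.
  have htangent : ∫ x in A, Real.exp (-c) * (1 + c - L x) ∂Q ≤ ∫ x in A, Real.exp (-L x) ∂Q := by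
    refine integral_mono (((integrable_const _).sub hLi.integrableOn).const_mul _)
      hexp.integrableOn fun x => ?_
    have h1 := Real.add_one_le_exp (c - L x)
    calc Real.exp (-c) * (1 + c - L x) ≤ Real.exp (-c) * Real.exp (c - L x) :=
          mul_le_mul_of_nonneg_left (by linarith) (Real.exp_pos _).le
      _ = Real.exp (-L x) := by rw [← Real.exp_add]; congr 1; ring
  rw [integral_const_mul, integral_sub (integrable_const _) hLi.integrableOn,
    setIntegral_const, smul_eq_mul] at htangent
  rw [hPA]
  refine le_trans ?_ htangent
  rw [mul_comm]
  refine mul_le_mul_of_nonneg_left ?_ (Real.exp_pos _).le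
  change q ≤ q * (1 + c) - _
  linarith

/-- The log-likelihood ratio of `N(ν, s²)` against `N(μ, s²)`. -/
noncomputable def gaussianLLR (s μ ν x : ℝ) : ℝ := (ν - μ) * (2 * x - μ - ν) / (2 * s ^ 2)

lemma continuous_gaussianLLR (s μ ν : ℝ) : Continuous (gaussianLLR s μ ν) := by
  unfold gaussianLLR; fun_prop

lemma gaussianReal_eq_withDensity_gaussianReal {s : ℝ} (hs : 0 < s) (μ ν : ℝ) :
    gaussianReal μ (s ^ 2).toNNReal = (gaussianReal ν (s ^ 2).toNNReal).withDensity
      fun x => ENNReal.ofReal (Real.exp (-gaussianLLR s μ ν x)) := by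
  have hv : (s ^ 2).toNNReal ≠ 0 := (Real.toNNReal_pos.2 (by positivity)).ne'
  have hm : Measurable fun x => ENNReal.ofReal (Real.exp (-gaussianLLR s μ ν x)) :=
    (Real.measurable_exp.comp (continuous_gaussianLLR s μ ν).measurable.neg).ennreal_ofReal
  rw [gaussianReal_of_var_ne_zero _ hv, gaussianReal_of_var_ne_zero _ hv,
    ← withDensity_mul _ (measurable_gaussianPDF _ _) hm]
  congr 1
  funext x
  rw [Pi.mul_apply, gaussianPDF, gaussianPDF, ← ENNReal.ofReal_mul (gaussianPDFReal_nonneg _ _ _),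
    gaussianPDFReal, gaussianPDFReal, mul_assoc _ _ (Real.exp _), ← Real.exp_add,
    Real.coe_toNNReal _ (sq_nonneg s)]
  congr 3
  unfold gaussianLLR
  field_simp
  ring

lemma integrable_gaussianLLR (s μ ν : ℝ) (v : NNReal) :
    Integrable (gaussianLLR s μ ν) (gaussianReal ν v) := by
  have hid : Integrable (fun x : ℝ => x) (gaussianReal ν v) :=
    (memLp_id_gaussianReal 1).integrable le_rfl
  exact ((((hid.const_mul 2).sub (integrable_const μ)).sub (integrable_const ν)).const_mul
    (ν - μ)).div_const _

/-- For `v = s²` this is the Kullback–Leibler divergence of `N(ν, s²)` from `N(μ, s²)`. The ratio is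
affine in `x`, so only the mean `ν` of the integrating law matters. -/
lemma integral_gaussianLLR (s μ ν : ℝ) (v : NNReal) :
    ∫ x, gaussianLLR s μ ν x ∂(gaussianReal ν v) = (ν - μ) ^ 2 / (2 * s ^ 2) := by
  have hid : Integrable (fun x : ℝ => x) (gaussianReal ν v) :=
    (memLp_id_gaussianReal 1).integrable le_rfl
  unfold gaussianLLR
  have hid' : Integrable (fun x : ℝ => 2 * x - μ) (gaussianReal ν v) :=
    (hid.const_mul 2).sub (integrable_const μ)
  rw [integral_div, integral_const_mul, integral_sub hid' (integrable_const ν),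
    integral_sub (hid.const_mul 2) (integrable_const μ), integral_const_mul,
    integral_id_gaussianReal]
  simp only [integral_const, probReal_univ, smul_eq_mul]
  ring

end ChangeOfMeasure

/-! ### Independent Gaussian alternatives and the expected log-likelihood ratio. -/

section GaussianInstance
variable {K : ℕ}

lemma gaussianInstance_map_eval (σ ν : Fin K → ℝ) (a : Fin K) :
    (gaussianInstance σ ν : Measure (Fin K → ℝ)).map (fun y => y a) =
      gaussianReal (ν a) (σ a ^ 2).toNNReal :=
  (measurePreserving_eval (fun a => gaussianReal (ν a) (σ a ^ 2).toNNReal) a).map_eq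

lemma integrable_eval_gaussianInstance (σ ν : Fin K → ℝ) (a : Fin K) :
    Integrable (fun y : Fin K → ℝ => y a) (gaussianInstance σ ν : Measure (Fin K → ℝ)) := by
  have h : Integrable (fun x : ℝ => x) (gaussianReal (ν a) (σ a ^ 2).toNNReal) :=
    (memLp_id_gaussianReal 1).integrable le_rfl
  rw [← gaussianInstance_map_eval σ ν a] at h
  exact h.comp_measurable (measurable_pi_apply a)

lemma mean_gaussianInstance (σ ν : Fin K → ℝ) (a : Fin K) :
    mean (gaussianInstance σ ν) a = ν a := by
  have h := integral_map (μ := (gaussianInstance σ ν : Measure (Fin K → ℝ)))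
    (measurable_pi_apply a).aemeasurable
    (f := fun x : ℝ => x) measurable_id.aestronglyMeasurable
  rw [mean, ← h]
  exact (congrArg (fun m : Measure ℝ => ∫ x, x ∂m) (gaussianInstance_map_eval σ ν a)).trans
    integral_id_gaussianReal

lemma isBestArm_gaussianInstance {σ ν : Fin K → ℝ} {b : Fin K} (hb : ∀ c, c ≠ b → ν c < ν b) :
    IsBestArm (gaussianInstance σ ν) b := by
  intro c hc
  rw [mean_gaussianInstance, mean_gaussianInstance]
  exact hb c hc

lemma gaussianInstance_mem_allInstances {σ ν : Fin K → ℝ} {b : Fin K}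
    (hb : ∀ c, c ≠ b → ν c < ν b) : gaussianInstance σ ν ∈ allInstances K :=
  ⟨integrable_eval_gaussianInstance σ ν, b, isBestArm_gaussianInstance hb⟩

/-- The log-likelihood ratio of an observed history. -/
noncomputable def historyLLR (σ μ ν : Fin K → ℝ) {t : ℕ} (x : Fin t → Fin K × ℝ) : ℝ :=
  ∑ s, gaussianLLR (σ (x s).1) (μ (x s).1) (ν (x s).1) (x s).2

lemma measurable_historyLLR (σ μ ν : Fin K → ℝ) (t : ℕ) :
    Measurable (historyLLR σ μ ν : (Fin t → Fin K × ℝ) → ℝ) := by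
  have h : Measurable fun p : Fin K × ℝ => gaussianLLR (σ p.1) (μ p.1) (ν p.1) p.2 :=
    measurable_from_prod_countable_right fun a =>
      (continuous_gaussianLLR (σ a) (μ a) (ν a)).measurable
  exact Finset.measurable_sum _ fun s _ => h.comp (measurable_pi_apply s)

lemma map_history_eq_withDensity_historyLLR {σ μ : Fin K → ℝ} (hσ : ∀ a, 0 < σ a)
    {P : Instance K} (hP : ∀ a, (P : Measure (Fin K → ℝ)).map (fun y => y a) =
      gaussianReal (μ a) (σ a ^ 2).toNNReal) (ν : Fin K → ℝ) (π : Strategy K) (T t : ℕ) :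
    (outcomeLaw P).map (fun y => π.history T y t) =
      ((outcomeLaw (gaussianInstance σ ν)).map fun y => π.history T y t).withDensity
        fun x => ENNReal.ofReal (Real.exp (-historyLLR σ μ ν x)) := by
  rw [map_history_eq_withDensity π T P (gaussianInstance σ ν)
    (g := fun a x => ENNReal.ofReal (Real.exp (-gaussianLLR (σ a) (μ a) (ν a) x)))
    (fun a => (Real.measurable_exp.comp
      (continuous_gaussianLLR _ _ _).measurable.neg).ennreal_ofReal)
    (fun a => by
      rw [hP, gaussianInstance_map_eval]
      exact gaussianReal_eq_withDensity_gaussianReal (hσ a) _ _)]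
  congr 1
  funext x
  rw [historyLLR, ← Finset.sum_neg_distrib, Real.exp_sum,
    ENNReal.ofReal_prod_of_nonneg fun _ _ => (Real.exp_pos _).le]

lemma map_eval_eval_outcomeLaw (P : Instance K) (t : ℕ) (a : Fin K) :
    (outcomeLaw P).map (fun y => y t a) = (P : Measure (Fin K → ℝ)).map fun z => z a := by
  rw [← outcomeLaw_map_eval P t, Measure.map_map (measurable_pi_apply a) (measurable_pi_apply t)]
  rfl

lemma integrable_arm_eq (π : Strategy K) (T t : ℕ) (a : Fin K) (P : Instance K) :
    Integrable (fun y => if π.arm T t y = a then (1 : ℝ) else 0) (outcomeLaw P) := by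
  have hm : Measurable fun y => if π.arm T t y = a then (1 : ℝ) else 0 :=
    Measurable.ite (π.measurable_arm T t (measurableSet_singleton a)) measurable_const
      measurable_const
  refine Integrable.of_bound hm.aestronglyMeasurable 1 (ae_of_all _ fun y => ?_)
  split_ifs <;> simp

/-- Splitting over arms turns the outcome of a random arm into terms pairing an indicator determined
by the past with a fresh outcome of a fixed arm. -/
lemma gaussianLLR_arm_eq_sum (σ μ ν : Fin K → ℝ) (π : Strategy K) (T t : ℕ)
    (y : ℕ → Fin K → ℝ) :
    gaussianLLR (σ (π.arm T t y)) (μ (π.arm T t y)) (ν (π.arm T t y)) (y t (π.arm T t y)) =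
      ∑ a, (if π.arm T t y = a then (1 : ℝ) else 0) * gaussianLLR (σ a) (μ a) (ν a) (y t a) := by
  simp

/-- The indicator is a function of the history and the ratio a function of the next vector, so
independence gives integrability of the product and factors its mean. -/
lemma integrable_and_integral_arm_mul_gaussianLLR (σ μ ν : Fin K → ℝ) (π : Strategy K) (T t : ℕ)
    (a : Fin K) :
    Integrable (fun y => (if π.arm T t y = a then (1 : ℝ) else 0) *
        gaussianLLR (σ a) (μ a) (ν a) (y t a)) (outcomeLaw (gaussianInstance σ ν)) ∧
      ∫ y, (if π.arm T t y = a then (1 : ℝ) else 0) * gaussianLLR (σ a) (μ a) (ν a) (y t a)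
        ∂(outcomeLaw (gaussianInstance σ ν)) =
      (∫ y, (if π.arm T t y = a then (1 : ℝ) else 0) ∂(outcomeLaw (gaussianInstance σ ν))) *
        ((ν a - μ a) ^ 2 / (2 * σ a ^ 2)) := by
  have hcont := continuous_gaussianLLR (σ a) (μ a) (ν a)
  have hlaw : (outcomeLaw (gaussianInstance σ ν)).map (fun y => y t a) =
      gaussianReal (ν a) (σ a ^ 2).toNNReal := by
    rw [map_eval_eval_outcomeLaw, gaussianInstance_map_eval]
  have hmeas : Measurable fun y : ℕ → Fin K → ℝ => y t a :=
    (measurable_pi_apply a).comp (measurable_pi_apply t)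
  have hint : Integrable (fun y => gaussianLLR (σ a) (μ a) (ν a) (y t a))
      (outcomeLaw (gaussianInstance σ ν)) := by
    have h := integrable_gaussianLLR (σ a) (μ a) (ν a) (σ a ^ 2).toNNReal
    rw [← hlaw] at h
    exact h.comp_measurable hmeas
  have hval : ∫ y, gaussianLLR (σ a) (μ a) (ν a) (y t a) ∂(outcomeLaw (gaussianInstance σ ν)) =
      (ν a - μ a) ^ 2 / (2 * σ a ^ 2) := by
    rw [← integral_gaussianLLR (σ a) (μ a) (ν a) (σ a ^ 2).toNNReal, ← hlaw,
      integral_map hmeas.aemeasurable hcont.measurable.aestronglyMeasurable]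
  have hind : IndepFun (fun y => if π.arm T t y = a then (1 : ℝ) else 0)
      (fun y => gaussianLLR (σ a) (μ a) (ν a) (y t a)) (outcomeLaw (gaussianInstance σ ν)) :=
    (π.indepFun_history T t (gaussianInstance σ ν)).comp
      (φ := fun x => if π.alloc T t x = a then (1 : ℝ) else 0)
      (ψ := fun z : Fin K → ℝ => gaussianLLR (σ a) (μ a) (ν a) (z a))
      (Measurable.ite (π.measurable_alloc T t (measurableSet_singleton a)) measurable_const
        measurable_const) (hcont.measurable.comp (measurable_pi_apply a))
  have hint1 := integrable_arm_eq π T t a (gaussianInstance σ ν)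
  refine ⟨hind.integrable_mul hint1 hint, ?_⟩
  rw [hind.integral_fun_mul_eq_mul_integral hint1.aestronglyMeasurable hint.aestronglyMeasurable,
    hval]

lemma historyLLR_history (σ μ ν : Fin K → ℝ) (π : Strategy K) (T : ℕ) (y : ℕ → Fin K → ℝ) :
    historyLLR σ μ ν (π.history T y T) = ∑ t ∈ Finset.range T, ∑ a,
      (if π.arm T t y = a then (1 : ℝ) else 0) * gaussianLLR (σ a) (μ a) (ν a) (y t a) := by
  simp_rw [← gaussianLLR_arm_eq_sum, historyLLR, π.history_apply T T]
  exact Fin.sum_univ_eq_sum_range (fun t => gaussianLLR (σ (π.arm T t y)) (μ (π.arm T t y))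
    (ν (π.arm T t y)) (y t (π.arm T t y))) T

lemma integrable_historyLLR (σ μ ν : Fin K → ℝ) (π : Strategy K) (T : ℕ) :
    Integrable (fun y => historyLLR σ μ ν (π.history T y T))
      (outcomeLaw (gaussianInstance σ ν)) := by
  simp_rw [historyLLR_history]
  exact integrable_finsetSum _ fun t _ => integrable_finsetSum _ fun a _ =>
    (integrable_and_integral_arm_mul_gaussianLLR σ μ ν π T t a).1

/-- The expected log-likelihood ratio is the allocation-weighted sum of the divergences. -/
lemma integral_historyLLR (σ μ ν : Fin K → ℝ) (π : Strategy K) {T : ℕ} (hT : 0 < T) :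
    ∫ y, historyLLR σ μ ν (π.history T y T) ∂(outcomeLaw (gaussianInstance σ ν)) =
      T * ∑ a, allocationRatio π T (gaussianInstance σ ν) a *
        ((ν a - μ a) ^ 2 / (2 * σ a ^ 2)) := by
  have hT' : (T : ℝ) ≠ 0 := by positivity
  simp_rw [historyLLR_history]
  rw [integral_finsetSum _ fun t _ => integrable_finsetSum _ fun a _ =>
    (integrable_and_integral_arm_mul_gaussianLLR σ μ ν π T t a).1]
  simp_rw [integral_finsetSum _ fun a _ =>
    (integrable_and_integral_arm_mul_gaussianLLR σ μ ν π T _ a).1,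
    fun t a => (integrable_and_integral_arm_mul_gaussianLLR σ μ ν π T t a).2]
  rw [Finset.sum_comm, Finset.mul_sum]
  refine Finset.sum_congr rfl fun a _ => ?_
  rw [allocationRatio, integral_const_mul,
    integral_finsetSum _ fun t _ => integrable_arm_eq π T t a _, ← Finset.sum_mul]
  field_simp

end GaussianInstance

/-! ### From one alternative instance to the bound on the error exponent. -/

section LowerBound
variable {K : ℕ} {σ μ ν : Fin K → ℝ} {astar : Fin K}

/-- The change-of-measure bound applied to the laws of the full history, in logarithmic form and
divided by `T`. -/
lemma complexity_le (hσ : ∀ a, 0 < σ a) {P : Instance K}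
    (hP : ∀ a, (P : Measure (Fin K → ℝ)).map (fun y => y a) =
      gaussianReal (μ a) (σ a ^ 2).toNNReal) (ν : Fin K → ℝ) (π : Strategy K) {T : ℕ} (hT : 0 < T)
    {q S : ℝ} (hq : q = (outcomeLaw (gaussianInstance σ ν)).real {y | π.recommended T y ≠ astar})
    (hq0 : 0 < q)
    (hS : S = ∑ a, allocationRatio π T (gaussianInstance σ ν) a *
      ((ν a - μ a) ^ 2 / (2 * σ a ^ 2))) :
    complexity π P astar T ≤ (((S + 1 / T) / q - Real.log q * (1 / T) : ℝ) : EReal) := by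
  have hT' : (0 : ℝ) < T := by positivity
  have hH := π.measurable_history T T
  have hA : MeasurableSet {x : Fin T → Fin K × ℝ | π.recommend T x ≠ astar} :=
    π.measurable_recommend T (measurableSet_singleton astar).compl
  have hreal (R : Instance K) : ((outcomeLaw R).map fun y => π.history T y T).real
      {x | π.recommend T x ≠ astar} = (outcomeLaw R).real {y | π.recommended T y ≠ astar} :=
    map_measureReal_apply hH hA
  have hprob (R : Instance K) :
      IsProbabilityMeasure ((outcomeLaw R).map fun y => π.history T y T) :=
    Measure.isProbabilityMeasure_map hH.aemeasurable
  have hL := measurable_historyLLR σ μ ν T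
  have hbound := mul_exp_neg_le_measureReal hL
    ((integrable_map_measure hL.aestronglyMeasurable hH.aemeasurable).2
      (integrable_historyLLR σ μ ν π T))
    (map_history_eq_withDensity_historyLLR hσ hP ν π T T) hA (by rw [hreal, ← hq]; exact hq0)
  rw [hreal, hreal, ← hq, integral_map hH.aemeasurable hL.aestronglyMeasurable,
    integral_historyLLR σ μ ν π hT, ← hS] at hbound
  -- The error probability under `P` is positive, so the convention for `log 0` plays no role here.
  have hp := (mul_pos hq0 (Real.exp_pos _)).trans_le hbound
  have hlog := Real.log_le_log (mul_pos hq0 (Real.exp_pos _)) hbound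
  rw [Real.log_mul hq0.ne' (Real.exp_pos _).ne', Real.log_exp] at hlog
  rw [complexity, ← ENNReal.ofReal_toReal (measure_ne_top (outcomeLaw P) _), ← measureReal_def,
    ENNReal.log_ofReal_of_pos hp, ← EReal.coe_mul, EReal.coe_le_coe_iff]
  have h1 := mul_le_mul_of_nonneg_left hlog (one_div_pos.2 hT').le
  have h2 : 1 / (T : ℝ) * (Real.log q + -((T * S + 1) / q)) =
      -((S + 1 / T) / q - Real.log q * (1 / T)) := by
    field_simp
    ring
  linarith

variable {ℳ : Set (Instance K)} {π : Strategy K} {P : Instance K} {w : Fin K → ℝ}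

/-- Under the alternative an error relative to `astar` becomes almost certain, so in the bound for
fixed `T` the factor `q` tends to one and the allocation ratios to `w`. -/
lemma limsup_complexity_le_of_bestArm_ne (hσ : ∀ a, 0 < σ a)
    (hP : ∀ a, (P : Measure (Fin K → ℝ)).map (fun y => y a) =
      gaussianReal (μ a) (σ a ^ 2).toNNReal)
    (hℳ : ∀ ν : Fin K → ℝ, gaussianInstance σ ν ∈ allInstances K → gaussianInstance σ ν ∈ ℳ)
    (hcons : IsConsistent ℳ π)
    (hw : ∀ P ∈ ℳ, ∀ a, Tendsto (fun T : ℕ => allocationRatio π T P a) atTop (𝓝 (w a)))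
    {b : Fin K} (hb : b ≠ astar) (hν : ∀ c, c ≠ b → ν c < ν b) :
    limsup (fun T : ℕ => complexity π P astar T) atTop ≤
      ((∑ a, w a * ((ν a - μ a) ^ 2 / (2 * σ a ^ 2)) : ℝ) : EReal) := by
  have hmem : gaussianInstance σ ν ∈ ℳ := hℳ ν (gaussianInstance_mem_allInstances hν)
  have hq : Tendsto (fun T : ℕ => (outcomeLaw (gaussianInstance σ ν)).real
      {y | π.recommended T y ≠ astar}) atTop (𝓝 1) := by
    have h1 := hcons _ hmem b (isBestArm_gaussianInstance hν)
    have h2 := (ENNReal.tendsto_toReal ENNReal.one_ne_top).comp h1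
    refine tendsto_of_tendsto_of_tendsto_of_le_of_le h2 tendsto_const_nhds (fun T => ?_)
      fun T => measureReal_le_one
    refine measureReal_mono fun y hy => ?_
    simp only [Set.mem_ofPred_eq] at hy ⊢
    rw [hy]
    exact hb
  have hS : Tendsto (fun T : ℕ => ∑ a, allocationRatio π T (gaussianInstance σ ν) a *
      ((ν a - μ a) ^ 2 / (2 * σ a ^ 2))) atTop
      (𝓝 (∑ a, w a * ((ν a - μ a) ^ 2 / (2 * σ a ^ 2)))) :=
    tendsto_finsetSum _ fun a _ => (hw _ hmem a).mul_const _
  have hT : Tendsto (fun T : ℕ => 1 / (T : ℝ)) atTop (𝓝 0) := tendsto_one_div_atTop_nhds_zero_nat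
  have hlim := ((hS.add hT).div hq one_ne_zero).sub ((hq.log one_ne_zero).mul hT)
  simp only [add_zero, div_one, mul_zero, sub_zero] at hlim
  have hE := (continuous_coe_real_ereal.tendsto _).comp hlim
  rw [← hE.limsup_eq]
  refine limsup_le_limsup ?_
  filter_upwards [hq.eventually_const_lt one_pos, eventually_gt_atTop 0] with T hqT hT0
  exact complexity_le hσ hP ν π hT0 rfl hqT rfl

/-- Ties among the arms other than `astar` are removed by an arbitrarily small perturbation. -/
lemma limsup_complexity_le_of_exists_le (hσ : ∀ a, 0 < σ a)
    (hP : ∀ a, (P : Measure (Fin K → ℝ)).map (fun y => y a) =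
      gaussianReal (μ a) (σ a ^ 2).toNNReal)
    (hℳ : ∀ ν : Fin K → ℝ, gaussianInstance σ ν ∈ allInstances K → gaussianInstance σ ν ∈ ℳ)
    (hcons : IsConsistent ℳ π)
    (hw : ∀ P ∈ ℳ, ∀ a, Tendsto (fun T : ℕ => allocationRatio π T P a) atTop (𝓝 (w a)))
    {a : Fin K} (ha : a ≠ astar) (hν : ν astar ≤ ν a) :
    limsup (fun T : ℕ => complexity π P astar T) atTop ≤
      ((∑ a, w a * ((ν a - μ a) ^ 2 / (2 * σ a ^ 2)) : ℝ) : EReal) := by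
  -- The arm `b` may differ from `a`: any best arm other than `astar` serves.
  obtain ⟨b, hb, hmax⟩ := Finset.exists_max_image (Finset.univ.erase astar) ν ⟨a, by simp [ha]⟩
  have hb' := Finset.ne_of_mem_erase hb
  have hmax' : ∀ c, ν c ≤ ν b := by
    intro c
    by_cases hc : c = astar
    · rw [hc]; exact hν.trans (hmax a (by simp [ha]))
    · exact hmax c (by simp [hc])
  have hcont : Continuous fun ε : ℝ =>
      ∑ c, w c * ((Function.update ν b (ν b + ε) c - μ c) ^ 2 / (2 * σ c ^ 2)) := by
    refine continuous_finsetSum _ fun c _ => ?_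
    have : Continuous fun ε : ℝ => Function.update ν b (ν b + ε) c := by
      by_cases hc : c = b
      · subst hc; simp only [Function.update_self]; fun_prop
      · simp only [Function.update_of_ne hc]; fun_prop
    fun_prop
  have hlim := (continuous_coe_real_ereal.comp hcont).tendsto (0 : ℝ)
  simp only [Function.comp_apply, add_zero, Function.update_eq_self] at hlim
  -- The bound holds for every `ε > 0` and is continuous in `ε`, so it persists at `ε = 0`.
  refine ge_of_tendsto (hlim.mono_left nhdsWithin_le_nhds : Tendsto _ (𝓝[>] (0 : ℝ)) _) ?_
  filter_upwards [self_mem_nhdsWithin] with ε hε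
  refine limsup_complexity_le_of_bestArm_ne hσ hP hℳ hcons hw hb' fun c hc => ?_
  rw [Function.update_of_ne hc, Function.update_self]
  exact (hmax' c).trans_lt (lt_add_of_pos_right _ hε)

/-- The right-hand side is the least cost, in `w`-weighted divergence, of making `astar` and `a` tie
when all other means stay fixed. -/
lemma limsup_complexity_le_Omega (hσ : ∀ a, 0 < σ a)
    (hP : ∀ a, (P : Measure (Fin K → ℝ)).map (fun y => y a) =
      gaussianReal (μ a) (σ a ^ 2).toNNReal)
    (hℳ : ∀ ν : Fin K → ℝ, gaussianInstance σ ν ∈ allInstances K → gaussianInstance σ ν ∈ ℳ)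
    (hcons : IsConsistent ℳ π) (hwmem : w ∈ allocations K)
    (hw : ∀ P ∈ ℳ, ∀ a, Tendsto (fun T : ℕ => allocationRatio π T P a) atTop (𝓝 (w a)))
    {a : Fin K} (ha : a ≠ astar) :
    limsup (fun T : ℕ => complexity π P astar T) atTop ≤
      (((μ astar - μ a) ^ 2 / (2 * Omega σ w astar a) : ℝ) : EReal) := by
  have hO := Omega_pos hσ hwmem astar a
  have hs := hσ astar
  have hsa := hσ a
  have hu := (hwmem.1 astar).1
  have hv := (hwmem.1 a).1
  set Δ := μ astar - μ a with hΔ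
  -- The share of the gap closed by lowering `astar`; it minimizes `w astar * x² / σ astar² + w a *
  -- (1 - x)² / σ a²`.
  set x := σ astar ^ 2 / w astar / Omega σ w astar a with hx
  have hx' : 1 - x = σ a ^ 2 / w a / Omega σ w astar a := by
    rw [hx, one_sub_div hO.ne', Omega]; congr 1; ring
  let ν := Function.update (Function.update μ a (μ a + Δ * (1 - x))) astar (μ astar - Δ * x)
  have hνs : ν astar = μ astar - Δ * x := Function.update_self ..
  have hνa : ν a = μ a + Δ * (1 - x) := by simp [ν, Function.update_of_ne ha]
  have hνc : ∀ c, c ≠ astar → c ≠ a → ν c = μ c := fun c h1 h2 => by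
    simp [ν, Function.update_of_ne h1, Function.update_of_ne h2]
  have h := limsup_complexity_le_of_exists_le hσ hP hℳ hcons hw ha
    (show ν astar ≤ ν a by rw [hνs, hνa, hΔ]; linarith)
  refine h.trans_eq ?_
  congr 1
  rw [← Finset.sum_subset (Finset.subset_univ {astar, a}), Finset.sum_pair ha.symm, hνs, hνa]
  · have h1 : (μ astar - Δ * x - μ astar) ^ 2 = Δ ^ 2 * x ^ 2 := by ring
    have h2 : (μ a + Δ * (1 - x) - μ a) ^ 2 = Δ ^ 2 * (1 - x) ^ 2 := by ring
    rw [h1, h2, hx', hx]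
    have h3 : Omega σ w astar a = σ astar ^ 2 / w astar + σ a ^ 2 / w a := rfl
    set O := Omega σ w astar a
    have h4 : σ astar ^ 2 / w astar = O - σ a ^ 2 / w a := by linarith
    have h5 : w astar * (Δ ^ 2 * (σ astar ^ 2 / w astar / O) ^ 2 / (2 * σ astar ^ 2)) =
        Δ ^ 2 / (2 * O ^ 2) * (σ astar ^ 2 / w astar) := by field_simp
    have h6 : w a * (Δ ^ 2 * (σ a ^ 2 / w a / O) ^ 2 / (2 * σ a ^ 2)) =
        Δ ^ 2 / (2 * O ^ 2) * (σ a ^ 2 / w a) := by field_simp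
    rw [h5, h6, ← mul_add, ← h3]
    field_simp
  · intro c _ hc
    simp only [Finset.mem_insert, Finset.mem_singleton, not_or] at hc
    rw [hνc c hc.1 hc.2]
    simp

end LowerBound

end FixedBudgetBAI

/-! ### Combination of the exponent bound with the max-min problem. -/

theorem mainTheorem6 (K : ℕ) (hK : 2 ≤ K) (σ : Fin K → ℝ) (hσ : ∀ a, 0 < σ a)
    (Δlo Δhi : ℝ) (hΔlo : 0 < Δlo) (hΔ : Δlo ≤ Δhi) (astar : Fin K) :
    (∀ ℳ : Set (FixedBudgetBAI.Instance K), ℳ ⊆ FixedBudgetBAI.allInstances K →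
      (∀ μ : Fin K → ℝ,
        FixedBudgetBAI.gaussianInstance σ μ ∈ FixedBudgetBAI.allInstances K →
        FixedBudgetBAI.gaussianInstance σ μ ∈ ℳ) →
      ∀ P₀ ∈ FixedBudgetBAI.gaussianModel σ astar Δlo Δhi,
      ∀ π : FixedBudgetBAI.Strategy K,
        FixedBudgetBAI.IsConsistent ℳ π →
        FixedBudgetBAI.IsAsymptoticallyInvariant ℳ π →
        Filter.limsup (fun T : ℕ => FixedBudgetBAI.complexity π P₀ astar T) Filter.atTop ≤
          ((FixedBudgetBAI.uniformBound σ astar Δhi : ℝ) : EReal)) ∧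
    {w | w ∈ FixedBudgetBAI.allocations K ∧
        IsMaxOn (FixedBudgetBAI.allocationValue σ astar Δhi) (FixedBudgetBAI.allocations K) w} =
      {FixedBudgetBAI.targetAllocation σ astar} ∧
    FixedBudgetBAI.allocationValue σ astar Δhi (FixedBudgetBAI.targetAllocation σ astar) =
      FixedBudgetBAI.uniformBound σ astar Δhi := by
  have hΔhi : 0 < Δhi := hΔlo.trans_le hΔ
  refine ⟨?_, FixedBudgetBAI.setOf_isMaxOn_allocationValue hK hσ astar hΔhi,
    FixedBudgetBAI.allocationValue_targetAllocation hK hσ astar Δhi⟩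
  rintro ℳ - hℳ P₀ ⟨-, μ, hP₀, hgap⟩ π hcons ⟨w, hwmem, hw⟩
  have hfinite : Nonempty {a : Fin K // a ≠ astar} :=
    (FixedBudgetBAI.exists_ne_of_two_le hK astar).elim fun a ha => ⟨⟨a, ha⟩⟩
  -- The rival is chosen to attain the minimum in `allocationValue` at the strategy's own limit `w`.
  obtain ⟨⟨a, ha⟩, hmin⟩ := exists_eq_ciInf_of_finite
    (f := fun a : {a : Fin K // a ≠ astar} =>
      Δhi ^ 2 / (2 * FixedBudgetBAI.Omega σ w astar a))
  have hvalue := FixedBudgetBAI.allocationValue_le_uniformBound (astar := astar) hK hσ hΔhi hwmem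
  refine (FixedBudgetBAI.limsup_complexity_le_Omega hσ hP₀ hℳ hcons hwmem hw ha).trans ?_
  rw [EReal.coe_le_coe_iff]
  refine le_trans ?_ (hmin.trans_le hvalue)
  have hO := FixedBudgetBAI.Omega_pos hσ hwmem astar a
  have hnonneg : 0 ≤ μ astar - μ a := hΔlo.le.trans (hgap a ha).1
  have hle := (hgap a ha).2
  simp only
  gcongr
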